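/- Let $\mathrm{Diff}_1(\mathbb R)$ be the group of smooth diffeomorphisms $\phi:\mathbb R\to\mathbb R$ with $\phi(x+1)=1+\phi(x)$ for all $x\in\mathbb R$. A smooth path $\{\phi^t\}_{t\in[0,1]}$ in $\mathrm{Diff}_1(\mathbb R)$ (meaning that $(t,x)\mapsto\phi^t(x)$ is smooth on $[0,1]\times\mathbb R$) is generated by a unique Hamiltonian $H:[0,1]\times\mathbb R\to\mathbb R$, $1$-periodic in the second variable, through $\frac{\mathrm d}{\mathrm dt}\phi^t(x)=H(t,\phi^t(x))$. The path is called positive if $H>0$ everywhere, and in this case its $V$-length is $$\mathrm{length}_V(\{\phi^t\}_{t\in[0,1]})=\int_0^1\Bigl(\int_0^1\frac{\mathrm dx}{H(t,x)}\Bigr)^{-1}\mathrm dt .$$ For a natural number $k$, let $\mathcal P_k$ be the space of functions on $[0,1]\times\mathbb R$ of the form $p(t,x)=\sum_{j=0}^k\bigl(a_j(t)\cos(2\pi jx)+b_j(t)\sin(2\pi jx)\bigr)$ with $a_j,b_j:[0,1]\to\mathbb R$ smooth. Theorem. For every natural number $k\ge1$ and every $\phi\in\mathrm{Diff}_1(\mathbb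 R)$ the following hold. (i) If $\phi(x)\le x+\frac{s}{4k}$ for all $x\in\mathbb R$, for some $s\in(0,1)$, then every positive path $\{\phi^t\}_{t\in[0,1]}$ from $\mathrm{id}$ to $\phi$ which is generated by a Hamiltonian in $\mathcal P_k$ satisfies $$\mathrm{length}_V(\{\phi^t\}_{t\in[0,1]})\le\frac1{1-s}\int_0^1(\phi(x)-x)\,\mathrm dx .$$ (ii) If $\phi(x)>x+\frac1k$ for all $x\in\mathbb R$, then there exists $\psi\in\mathrm{Diff}_1(\mathbb R)$ with $x<\psi(x)<\phi(x)$ for all $x\in\mathbb R$ such that for every $L\in\mathbb R$ there is a positive path from $\mathrm{id}$ to $\psi$ which is generated by a Hamiltonian in $\mathcal P_k$ and has $V$-length larger than $L$. -/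

import Mathlib

open Set MeasureTheory
open scoped Manifold ContDiff

noncomputable section

/-- The group `Diff₁(ℝ)` of smooth diffeomorphisms `φ` of the real line with
`φ (x + 1) = 1 + φ x`: the universal cover of the group of orientation preserving
diffeomorphisms of the circle `ℝ / ℤ`. -/
def Diff1 : Type :=
  {φ : Diffeomorph 𝓘(ℝ, ℝ) 𝓘(ℝ, ℝ) ℝ ℝ ∞ // ∀ x : ℝ, φ (x + 1) = 1 + φ x}

namespace Diff1

instance : CoeFun Diff1 (fun _ => ℝ → ℝ) := ⟨fun φ => φ.1⟩

/-- The inverse diffeomorphism, as a function. -/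
def inv (φ : Diff1) : ℝ → ℝ := φ.1.symm

/-- The identity of `Diff₁(ℝ)`. -/
def refl : Diff1 := ⟨Diffeomorph.refl 𝓘(ℝ, ℝ) ℝ ∞, fun x => add_comm x 1⟩

/-- Smooth paths `{φᵗ}`, `t ∈ [0,1]`, in `Diff₁(ℝ)`: the map `(t, x) ↦ φᵗ(x)` is smooth on
`[0,1] × ℝ`. Only the values of `γ` on `[0,1]` matter, here and below. -/
def IsSmoothPath (γ : ℝ → Diff1) : Prop :=
  ContDiffOn ℝ ∞ (fun p : ℝ × ℝ => γ p.1 p.2) (Icc (0 : ℝ) 1 ×ˢ (univ : Set ℝ))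

/-- The Hamiltonian `H` generating a smooth path `{φᵗ}` in `Diff₁(ℝ)`: the function on
`[0,1] × ℝ` which is determined by `d/dt φᵗ = H (t, φᵗ)`, that is
`H (t, y) = (∂ₜ φᵗ) ((φᵗ)⁻¹ y)`. -/
def hamiltonian (γ : ℝ → Diff1) (t y : ℝ) : ℝ :=
  derivWithin (fun τ => γ τ ((γ t).inv y)) (Icc (0 : ℝ) 1) t

/-- `hamiltonian γ` is the unique solution `H` of `d/dt φᵗ = H (t, φᵗ)` on `[0,1] × ℝ`. -/
theorem generates_iff {γ : ℝ → Diff1} (hγ : IsSmoothPath γ) (H : ℝ → ℝ → ℝ) :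
    (∀ t ∈ Icc (0 : ℝ) 1, ∀ x : ℝ,
        HasDerivWithinAt (fun τ => γ τ x) (H t (γ t x)) (Icc (0 : ℝ) 1) t) ↔
      ∀ t ∈ Icc (0 : ℝ) 1, ∀ y : ℝ, H t y = hamiltonian γ t y := by
  have hu : UniqueDiffOn ℝ (Icc (0 : ℝ) 1) := uniqueDiffOn_Icc zero_lt_one
  constructor
  · intro h t ht y
    have h1 := (h t ht ((γ t).inv y)).derivWithin (hu t ht)
    have h2 : γ t ((γ t).inv y) = y := (γ t).1.apply_symm_apply y
    rw [h2] at h1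
    exact h1.symm
  · intro h t ht x
    rw [h t ht, hamiltonian]
    have h2 : (γ t).inv (γ t x) = x := (γ t).1.symm_apply_apply x
    rw [h2]
    apply DifferentiableWithinAt.hasDerivWithinAt
    have h3 : ContDiffOn ℝ ∞ (fun τ => γ τ x) (Icc (0 : ℝ) 1) :=
      hγ.comp (f := fun τ : ℝ => (τ, x)) (by fun_prop) (fun τ hτ => ⟨hτ, mem_univ _⟩)
    exact h3.differentiableOn (by simp) t ht

/-- Positive paths in `Diff₁(ℝ)`: smooth paths generated by a positive Hamiltonian. -/
def IsPositivePath (γ : ℝ → Diff1) : Prop :=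
  IsSmoothPath γ ∧ ∀ t ∈ Icc (0 : ℝ) 1, ∀ y : ℝ, 0 < hamiltonian γ t y

/-- The Lorentz–Finsler metric `V (h ∂/∂x) = (∫₀¹ dx / h(x))⁻¹` of a vector field with a
positive `1`-periodic coefficient `h`. -/
def lorentzV (h : ℝ → ℝ) : ℝ := (∫ x in (0 : ℝ)..1, (h x)⁻¹)⁻¹

/-- The `V`-length `∫₀¹ V (H (t, ·) ∂/∂x) dt` of the path generated by `H`. -/
def lengthV (γ : ℝ → Diff1) : ℝ := ∫ t in (0 : ℝ)..1, lorentzV (hamiltonian γ t)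

end Diff1

/-- The space `𝒫ₖ` of smooth functions on `[0,1] × ℝ` which are trigonometric polynomials of
degree at most `k` in the second variable. -/
def IsTrigPoly (k : ℕ) (p : ℝ → ℝ → ℝ) : Prop :=
  ∃ a b : ℕ → ℝ → ℝ,
    (∀ j, ContDiffOn ℝ ∞ (a j) (Icc (0 : ℝ) 1)) ∧
    (∀ j, ContDiffOn ℝ ∞ (b j) (Icc (0 : ℝ) 1)) ∧
    ∀ t ∈ Icc (0 : ℝ) 1, ∀ x : ℝ,
      p t x = ∑ j ∈ Finset.range (k + 1),
        (a j t * Real.cos (2 * Real.pi * j * x) + b j t * Real.sin (2 * Real.pi * j * x))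

end

/-! For (i), the harmonic mean gives V(H) ≤ ∫ H(t, x) dx, while ∫∫ H(t, φᵗ(x)) dx dt = ∫ (φ(x) - x)
dx, so it suffices to compare the means of p and p ∘ φᵗ for p = H(t, ·). Riesz interpolation
(`trigPolyDeriv_eq`) writes p' as a difference of two nonnegative combinations of translates of p.
If p ≥ 0, dropping the first gives p' ≥ -G, where G has mean πk times that of p. Since x ≤ φᵗ(x) ≤ x
+ s/(4k), composing with φᵗ lowers the mean at most by the factor 1 - πs/4 ≥ 1 - s
(`integral_trigPoly_comp_ge`).

For (ii), the fields spanned by 1, cos 2πkx, sin 2πkx form a copy of sl(2, ℝ), integrating to a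
k-fold cover of PSL(2, ℝ). On its positive elements V is the norm of a Lorentzian quadratic form
(`lorentzV_mobiusHam`). Translation by 1/k is central, so conjugating the rotation path from 0 to
1/k by a boost g leaves its endpoint unchanged. Its product with a translation path of speed ε ends
at translation by 1/k + ε, and its V-length is the norm of a sum of timelike vectors of norms 1/k
and ε. The cross term 2(ε/k) cosh grows without bound with the boost. -/

/-! ### Characters and the Fejér kernel -/

/-- The character `x ↦ exp (2 π i x)` of the real line. -/
noncomputable def expChar (x : ℝ) : ℂ := Complex.exp ((2 * Real.pi * x : ℝ) * Complex.I)

theorem expChar_add (x y : ℝ) : expChar (x + y) = expChar x * expChar y := by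
  rw [expChar, expChar, expChar, ← Complex.exp_add]
  push_cast
  ring_nf

theorem expChar_zero : expChar 0 = 1 := by simp [expChar]

theorem expChar_int (n : ℤ) : expChar n = 1 := by
  rw [expChar, Complex.exp_eq_one_iff]
  exact ⟨n, by push_cast; ring⟩

theorem conj_expChar (x : ℝ) : (starRingEnd ℂ) (expChar x) = expChar (-x) := by
  rw [expChar, expChar, ← Complex.exp_conj, map_mul, Complex.conj_ofReal, Complex.conj_I]
  push_cast
  ring_nf

theorem expChar_nat_mul (n : ℕ) (x : ℝ) : expChar (n * x) = expChar x ^ n := by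
  rw [expChar, expChar, ← Complex.exp_nat_mul]
  push_cast
  ring_nf

theorem expChar_re (x : ℝ) : (expChar x).re = Real.cos (2 * Real.pi * x) := by
  rw [expChar, Complex.exp_ofReal_mul_I_re]

theorem expChar_im (x : ℝ) : (expChar x).im = Real.sin (2 * Real.pi * x) := by
  rw [expChar, Complex.exp_ofReal_mul_I_im]

theorem expChar_eq_one_iff (x : ℝ) : expChar x = 1 ↔ ∃ n : ℤ, x = n := by
  constructor
  · intro h
    rw [expChar, Complex.exp_eq_one_iff] at h
    obtain ⟨n, hn⟩ := h
    refine ⟨n, ?_⟩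
    have h2 : (2 * Real.pi * Complex.I : ℂ) ≠ 0 := Complex.two_pi_I_ne_zero
    have h3 : (2 * Real.pi * Complex.I : ℂ) * x = (2 * Real.pi * Complex.I : ℂ) * (n : ℂ) := by
      rw [mul_comm _ (n : ℂ), ← hn]
      push_cast
      ring
    exact_mod_cast mul_left_cancel₀ h2 h3
  · rintro ⟨n, rfl⟩
    exact expChar_int n

/-- Orthogonality: sums of characters over a coset of the `k`-torsion points. -/
theorem sum_expChar {k : ℕ} (hk : 1 ≤ k) (l : ℤ) (c : ℝ) :
    ∑ r ∈ Finset.range k, expChar (l * (c + r / k)) =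
      if (k : ℤ) ∣ l then k * expChar (l * c) else 0 := by
  have hk0 : (k : ℝ) ≠ 0 := by positivity
  have h1 : ∀ r : ℕ, expChar (l * (c + r / k)) = expChar (l * c) * expChar (l / k) ^ r := by
    intro r
    rw [← expChar_nat_mul, ← expChar_add]
    congr 1
    ring
  simp_rw [h1]
  rw [← Finset.mul_sum]
  have h2 : expChar (l / k) = 1 ↔ (k : ℤ) ∣ l := by
    rw [expChar_eq_one_iff]
    refine exists_congr fun n => ?_
    rw [div_eq_iff hk0, mul_comm]
    exact_mod_cast Iff.rfl
  split_ifs with h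
  · rw [h2.2 h]
    simp [mul_comm]
  · rw [geom_sum_eq (fun h' => h (h2.1 h')), ← expChar_nat_mul, mul_div_cancel₀ _ hk0, expChar_int]
    simp

/-- The Fejér kernel. -/
noncomputable def fejer (k : ℕ) (x : ℝ) : ℝ :=
  ‖∑ a ∈ Finset.range k, expChar (a * x)‖ ^ 2 / k

theorem fejer_nonneg (k : ℕ) (x : ℝ) : 0 ≤ fejer k x := by
  unfold fejer
  positivity

theorem fejer_eq (k : ℕ) (x : ℝ) : (fejer k x : ℂ) =
    (∑ a ∈ Finset.range k, ∑ b ∈ Finset.range k, expChar (((a : ℤ) - (b : ℤ) : ℤ) * x)) / k := by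
  unfold fejer
  push_cast
  rw [← Complex.mul_conj', map_sum, Finset.sum_mul_sum]
  congr 1
  refine Finset.sum_congr rfl fun a _ => Finset.sum_congr rfl fun b _ => ?_
  rw [conj_expChar, ← expChar_add]
  congr 1
  ring

/-- Expand the kernel into characters of frequency j + a - b. By orthogonality each a retains only
the b congruent to j + a modulo k: either b = j + a, contributing 1 for k - j values of a, or b = j
+ a - k, contributing `expChar (k * c)` for the other j. -/
theorem sum_fejer_mul_expChar {k j : ℕ} (hk : 1 ≤ k) (hj : j ≤ k) (c : ℝ) :
    ∑ r ∈ Finset.range k, (fejer k (c + r / k) : ℂ) * expChar (j * (c + r / k)) =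
      (k - j) + j * expChar (k * c) := by
  have hk0 : (k : ℂ) ≠ 0 := by
    have : k ≠ 0 := by omega
    exact_mod_cast this
  have h1 : ∀ r : ℕ, (fejer k (c + r / k) : ℂ) * expChar (j * (c + r / k)) =
      ∑ a ∈ Finset.range k, ∑ b ∈ Finset.range k,
        expChar (((j : ℤ) + a - b : ℤ) * (c + r / k)) / k := by
    intro r
    rw [fejer_eq, div_mul_eq_mul_div, Finset.sum_mul, Finset.sum_div]
    refine Finset.sum_congr rfl fun a _ => ?_
    rw [Finset.sum_mul, Finset.sum_div]
    refine Finset.sum_congr rfl fun b _ => ?_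
    rw [← expChar_add]
    congr 2
    push_cast
    ring
  simp_rw [h1]
  rw [Finset.sum_comm]
  have h2 : ∀ a ∈ Finset.range k, ∑ r ∈ Finset.range k, ∑ b ∈ Finset.range k,
      expChar (((j : ℤ) + a - b : ℤ) * (c + r / k)) / k =
        if j + a < k then 1 else expChar (k * c) := by
    intro a ha
    rw [Finset.mem_range] at ha
    rw [Finset.sum_comm]
    simp_rw [← Finset.sum_div]
    simp_rw [sum_expChar hk]
    have h3 : ∀ b0 ∈ Finset.range k, (∀ b ∈ Finset.range k, (k : ℤ) ∣ (j : ℤ) + a - b ↔ b = b0) →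
        (∑ b ∈ Finset.range k, (if (k : ℤ) ∣ (j : ℤ) + a - b then
          (k : ℂ) * expChar (((j : ℤ) + a - b : ℤ) * c) else 0)) / k =
            expChar (((j : ℤ) + a - b0 : ℤ) * c) := by
      intro b0 hb0 h
      rw [Finset.sum_congr rfl (g := fun b => if b = b0 then
        (k : ℂ) * expChar (((j : ℤ) + a - b : ℤ) * c) else 0), Finset.sum_ite_eq', if_pos hb0,
        mul_div_cancel_left₀ _ hk0]
      intro b hb
      simp only [h b hb]
    split_ifs with hlt
    · rw [h3 (j + a) (by simpa using hlt)]
      · simp [expChar_zero]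
      · intro b hb
        rw [Finset.mem_range] at hb
        constructor
        · intro hd
          have := Int.eq_zero_of_abs_lt_dvd hd (by rw [abs_lt]; omega)
          omega
        · rintro rfl
          simp
    · rw [h3 (j + a - k) (by rw [Finset.mem_range]; omega)]
      · congr 2
        have : ((j : ℤ) + a - (j + a - k : ℕ) : ℤ) = k := by omega
        rw [this]
        simp
      · intro b hb
        rw [Finset.mem_range] at hb
        constructor
        · intro hd
          have hd' : (k : ℤ) ∣ (j : ℤ) + a - b - k := dvd_sub_self_right.2 hd
          have := Int.eq_zero_of_abs_lt_dvd hd' (by rw [abs_lt]; omega)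
          omega
        · rintro rfl
          exact ⟨1, by omega⟩
  rw [Finset.sum_congr rfl h2, Finset.sum_ite, Finset.sum_const, Finset.sum_const]
  have h4 : (Finset.range k).filter (fun a => j + a < k) = Finset.range (k - j) := by
    ext a
    simp only [Finset.mem_filter, Finset.mem_range]
    omega
  have h5 : (Finset.range k).filter (fun a => ¬ j + a < k) = Finset.Ico (k - j) k := by
    ext a
    simp only [Finset.mem_filter, Finset.mem_range, Finset.mem_Ico]
    omega
  rw [h4, h5]
  simp only [Finset.card_range, Nat.card_Ico, nsmul_eq_mul]
  rw [Nat.sub_sub_self hj]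
  push_cast [hj]
  ring

/-! ### Riesz interpolation and the one-sided Bernstein inequality -/

/-- A trigonometric polynomial of degree at most `k`. -/
noncomputable def trigPoly (k : ℕ) (a b : ℕ → ℝ) (x : ℝ) : ℝ :=
  ∑ j ∈ Finset.range (k + 1),
    (a j * Real.cos (2 * Real.pi * j * x) + b j * Real.sin (2 * Real.pi * j * x))

theorem trigPoly_eq_re (k : ℕ) (a b : ℕ → ℝ) (x : ℝ) :
    trigPoly k a b x =
      (∑ j ∈ Finset.range (k + 1), ((a j : ℂ) - b j * Complex.I) * expChar (j * x)).re := by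
  rw [trigPoly, Complex.re_sum]
  refine Finset.sum_congr rfl fun j _ => ?_
  simp [expChar_re, expChar_im, mul_assoc]

/-- The derivative of a trigonometric polynomial. -/
noncomputable def trigPolyDeriv (k : ℕ) (a b : ℕ → ℝ) : ℝ → ℝ :=
  trigPoly k (fun j => 2 * Real.pi * j * b j) (fun j => -(2 * Real.pi * j * a j))

theorem continuous_trigPoly (k : ℕ) (a b : ℕ → ℝ) : Continuous (trigPoly k a b) := by
  unfold trigPoly
  fun_prop

theorem trigPoly_periodic (k : ℕ) (a b : ℕ → ℝ) : Function.Periodic (trigPoly k a b) 1 := by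
  intro x
  unfold trigPoly
  refine Finset.sum_congr rfl fun j _ => ?_
  have : 2 * Real.pi * j * (x + 1) = 2 * Real.pi * j * x + j * (2 * Real.pi) := by ring
  rw [this, Real.cos_add_nat_mul_two_pi, Real.sin_add_nat_mul_two_pi]

theorem hasDerivAt_trigPoly (k : ℕ) (a b : ℕ → ℝ) (x : ℝ) :
    HasDerivAt (trigPoly k a b) (trigPolyDeriv k a b x) x := by
  unfold trigPolyDeriv trigPoly
  refine HasDerivAt.fun_sum fun j _ => ?_
  have h0 : HasDerivAt (fun x : ℝ => 2 * Real.pi * j * x) (2 * Real.pi * j) x := by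
    simpa using (hasDerivAt_id x).const_mul (2 * Real.pi * j)
  refine ((h0.cos.const_mul (a j)).fun_add (h0.sin.const_mul (b j))).congr_deriv ?_
  dsimp only
  ring

/-- The interpolation formula of M. Riesz for the derivative of a trigonometric polynomial. -/
theorem trigPolyDeriv_eq {k : ℕ} (hk : 1 ≤ k) (a b : ℕ → ℝ) (x : ℝ) :
    trigPolyDeriv k a b x = Real.pi *
      (∑ r ∈ Finset.range k,
          fejer k (1 / (4 * k) + r / k) * trigPoly k a b (x + (1 / (4 * k) + r / k)) -
        ∑ r ∈ Finset.range k,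
          fejer k (3 / (4 * k) + r / k) * trigPoly k a b (x + (3 / (4 * k) + r / k))) := by
  have hk0 : (k : ℝ) ≠ 0 := by positivity
  have h1 : ∀ c : ℝ, ∑ r ∈ Finset.range k,
        fejer k (c + r / k) * trigPoly k a b (x + (c + r / k)) =
      (∑ j ∈ Finset.range (k + 1), ((a j : ℂ) - b j * Complex.I) * expChar (j * x) *
        ((k - j) + j * expChar (k * c))).re := by
    intro c
    have h2 : ∀ r : ℕ, fejer k (c + r / k) * trigPoly k a b (x + (c + r / k)) =
        ((fejer k (c + r / k) : ℂ) * ∑ j ∈ Finset.range (k + 1),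
          ((a j : ℂ) - b j * Complex.I) * expChar (j * (x + (c + r / k)))).re := by
      intro r
      rw [Complex.re_ofReal_mul, trigPoly_eq_re]
    simp_rw [h2]
    rw [← Complex.re_sum]
    simp_rw [Finset.mul_sum]
    rw [Finset.sum_comm]
    congr 1
    refine Finset.sum_congr rfl fun j hj => ?_
    rw [← sum_fejer_mul_expChar hk (by simpa [Nat.lt_succ_iff] using hj), Finset.mul_sum]
    refine Finset.sum_congr rfl fun r _ => ?_
    rw [mul_add, expChar_add]
    ring
  -- The two families of nodes are those where `expChar (k * c)` is i and -i: in the difference k -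
  -- j cancels and 2ij remains, which times π is the multiplier 2πij of the derivative.
  have e1 : expChar (k * (1 / (4 * k))) = Complex.I := by
    have : 2 * Real.pi * (k * (1 / (4 * k))) = Real.pi / 2 := by field_simp; norm_num
    rw [expChar, this]
    push_cast
    exact Complex.exp_pi_div_two_mul_I
  have e3 : expChar (k * (3 / (4 * k))) = -Complex.I := by
    have : (k * (3 / (4 * k)) : ℝ) = -(k * (1 / (4 * k))) + (1 : ℤ) := by
      field_simp; push_cast; norm_num
    rw [this, expChar_add, expChar_int, ← conj_expChar, e1]
    simp
  rw [h1, h1, e1, e3, ← Complex.sub_re, ← Complex.re_ofReal_mul, ← Finset.sum_sub_distrib,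
    Finset.mul_sum, trigPolyDeriv, trigPoly_eq_re]
  congr 1
  refine Finset.sum_congr rfl fun j _ => ?_
  push_cast
  linear_combination (2 * Real.pi * j * b j * expChar (j * x)) * Complex.I_sq

theorem sum_fejer {k : ℕ} (hk : 1 ≤ k) (c : ℝ) :
    ∑ r ∈ Finset.range k, fejer k (c + r / k) = k := by
  have h := sum_fejer_mul_expChar hk (Nat.zero_le k) c
  simp only [Nat.cast_zero, zero_mul, expChar_zero, mul_one, sub_zero, add_zero] at h
  exact_mod_cast h

/-- A nonnegative trigonometric polynomial decreases at most as fast as an average of its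
translates; this is a one-sided Bernstein inequality. -/
theorem neg_sum_le_trigPolyDeriv {k : ℕ} (hk : 1 ≤ k) {a b : ℕ → ℝ}
    (h : ∀ x, 0 ≤ trigPoly k a b x) (x : ℝ) :
    -(Real.pi * ∑ r ∈ Finset.range k,
        fejer k (3 / (4 * k) + r / k) * trigPoly k a b (x + (3 / (4 * k) + r / k))) ≤
      trigPolyDeriv k a b x := by
  rw [trigPolyDeriv_eq hk, mul_sub, neg_le_sub_iff_le_add]
  have : 0 ≤ Real.pi * ∑ r ∈ Finset.range k,
      fejer k (1 / (4 * k) + r / k) * trigPoly k a b (x + (1 / (4 * k) + r / k)) :=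
    mul_nonneg Real.pi_pos.le (Finset.sum_nonneg fun r _ => mul_nonneg (fejer_nonneg _ _) (h _))
  linarith

theorem intervalIntegral_add_const_of_periodic {f : ℝ → ℝ} (hf : Function.Periodic f 1) (c : ℝ) :
    ∫ x in (0 : ℝ)..1, f (x + c) = ∫ x in (0 : ℝ)..1, f x := by
  rw [intervalIntegral.integral_comp_add_right, zero_add, add_comm (1 : ℝ) c]
  simpa using hf.intervalIntegral_add_eq c 0

/-- Moving the argument of a nonnegative trigonometric polynomial forward by at most `δ` decreases
the mean at most by the factor `1 - π k δ`. -/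
theorem integral_trigPoly_comp_ge {k : ℕ} (hk : 1 ≤ k) {a b : ℕ → ℝ}
    (h : ∀ x, 0 ≤ trigPoly k a b x) {f : ℝ → ℝ} (hf : Continuous f) {δ : ℝ}
    (hxf : ∀ x, x ≤ f x) (hfx : ∀ x, f x ≤ x + δ) :
    (1 - Real.pi * k * δ) * ∫ x in (0 : ℝ)..1, trigPoly k a b x ≤
      ∫ x in (0 : ℝ)..1, trigPoly k a b (f x) := by
  have hδ : 0 ≤ δ := by linarith [hxf 0, hfx 0]
  have hc := continuous_trigPoly k a b
  set G : ℝ → ℝ := fun z => Real.pi * ∑ r ∈ Finset.range k,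
    fejer k (3 / (4 * k) + r / k) * trigPoly k a b (z + (3 / (4 * k) + r / k)) with hG
  have hGc : Continuous G := by
    rw [hG]
    exact continuous_const.mul (continuous_finsetSum _ fun r _ =>
      continuous_const.mul (hc.comp (continuous_id.add continuous_const)))
  have hG0 : ∀ z, 0 ≤ G z := fun z => mul_nonneg Real.pi_pos.le
    (Finset.sum_nonneg fun r _ => mul_nonneg (fejer_nonneg _ _) (h _))
  have hGp : Function.Periodic G 1 := by
    intro z
    simp only [hG]
    congr 1
    refine Finset.sum_congr rfl fun r _ => ?_
    rw [add_right_comm, trigPoly_periodic]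
  have hGi : ∫ z in (0 : ℝ)..1, G z = Real.pi * k * ∫ x in (0 : ℝ)..1, trigPoly k a b x := by
    simp only [hG]
    rw [intervalIntegral.integral_const_mul, intervalIntegral.integral_finsetSum]
    · simp_rw [intervalIntegral.integral_const_mul,
        intervalIntegral_add_const_of_periodic (trigPoly_periodic k a b)]
      rw [← Finset.sum_mul, sum_fejer hk, mul_assoc]
    · intro r _
      exact (continuous_const.mul (hc.comp (continuous_id.add continuous_const))).intervalIntegrable
        _ _
  have hpt : ∀ x, trigPoly k a b x - ∫ z in (0 : ℝ)..δ, G (x + z) ≤ trigPoly k a b (f x) := by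
    intro x
    have hd : Continuous (trigPolyDeriv k a b) := continuous_trigPoly _ _ _
    have h1 := intervalIntegral.integral_eq_sub_of_hasDerivAt (a := x) (b := f x)
      (fun z _ => hasDerivAt_trigPoly k a b z) (hd.intervalIntegrable _ _)
    have h2 : ∫ z in x..f x, -G z ≤ ∫ z in x..f x, trigPolyDeriv k a b z :=
      intervalIntegral.integral_mono_on (hxf x) (hGc.neg.intervalIntegrable _ _)
        (hd.intervalIntegrable _ _) (fun z _ => neg_sum_le_trigPolyDeriv hk h z)
    rw [intervalIntegral.integral_neg] at h2
    -- Since G ≥ 0, enlarging the interval gives a bound independent of f, whose mean in x is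
    -- computable by Fubini.
    have h3 : ∫ z in x..f x, G z ≤ ∫ z in x..(x + δ), G z :=
      intervalIntegral.integral_mono_interval le_rfl (hxf x) (hfx x)
        (Filter.Eventually.of_forall hG0) (hGc.intervalIntegrable _ _)
    rw [intervalIntegral.integral_comp_add_left, add_zero]
    linarith
  have hGxz : Continuous (Function.uncurry fun x z => G (x + z)) := by
    exact hGc.comp (continuous_fst.add continuous_snd)
  have hswap : ∫ x in (0 : ℝ)..1, ∫ z in (0 : ℝ)..δ, G (x + z) =
      δ * ∫ z in (0 : ℝ)..1, G z := by
    rw [intervalIntegral_intervalIntegral_swap]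
    · simp_rw [intervalIntegral_add_const_of_periodic hGp]
      simp
    · rw [uIoc_of_le zero_le_one, uIoc_of_le hδ]
      exact (hGxz.continuousOn.integrableOn_compact (isCompact_Icc.prod isCompact_Icc)).mono_set
        (prod_mono Ioc_subset_Icc_self Ioc_subset_Icc_self)
  have hci : Continuous fun x => ∫ z in (0 : ℝ)..δ, G (x + z) :=
    intervalIntegral.continuous_parametric_intervalIntegral_of_continuous' hGxz 0 δ
  calc (1 - Real.pi * k * δ) * ∫ x in (0 : ℝ)..1, trigPoly k a b x
      = ∫ x in (0 : ℝ)..1, (trigPoly k a b x - ∫ z in (0 : ℝ)..δ, G (x + z)) := by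
        rw [intervalIntegral.integral_sub (hc.intervalIntegrable _ _)
          (hci.intervalIntegrable _ _), hswap, hGi]
        ring
    _ ≤ _ := intervalIntegral.integral_mono_on zero_le_one
        ((hc.sub hci).intervalIntegrable _ _) ((hc.comp hf).intervalIntegrable _ _)
        fun x _ => hpt x

/-! ### The upper bound on the V-length -/

namespace Diff1

/-- The harmonic mean is at most the arithmetic mean. -/
theorem lorentzV_le_integral {h : ℝ → ℝ} (hc : Continuous h) (hpos : ∀ x, 0 < h x) :
    lorentzV h ≤ ∫ x in (0 : ℝ)..1, h x := by
  have hi : Continuous fun x => (h x)⁻¹ := hc.inv₀ fun x => (hpos x).ne'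
  have h0 : 0 < ∫ x in (0 : ℝ)..1, (h x)⁻¹ :=
    intervalIntegral.intervalIntegral_pos_of_pos (hi.intervalIntegrable _ _)
      (fun x => inv_pos.2 (hpos x)) zero_lt_one
  set c := lorentzV h
  have hc1 : c * ∫ x in (0 : ℝ)..1, (h x)⁻¹ = 1 := inv_mul_cancel₀ h0.ne'
  -- The pointwise inequality 2c ≤ h + c²/h integrates to 2c ≤ ∫ h + c, because c ∫ 1/h = 1.
  have h1 : ∫ _x in (0 : ℝ)..1, 2 * c ≤ ∫ x in (0 : ℝ)..1, (h x + c ^ 2 * (h x)⁻¹) := by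
    refine intervalIntegral.integral_mono_on zero_le_one (by simp)
      ((hc.add (continuous_const.mul hi)).intervalIntegrable _ _) fun x _ => ?_
    have hx := hpos x
    have : h x + c ^ 2 * (h x)⁻¹ - 2 * c = (h x - c) ^ 2 * (h x)⁻¹ := by
      field_simp
      ring
    have h2 : 0 ≤ (h x - c) ^ 2 * (h x)⁻¹ := by positivity
    linarith
  rw [intervalIntegral.integral_add (hc.intervalIntegrable _ _)
    ((hi.intervalIntegrable _ _).const_mul _), intervalIntegral.integral_const_mul (c ^ 2)] at h1
  have h3 : c ^ 2 * ∫ x in (0 : ℝ)..1, (h x)⁻¹ = c := by rw [pow_two, mul_assoc, hc1, mul_one]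
  rw [h3] at h1
  simp at h1
  linarith

theorem lorentzV_nonneg {h : ℝ → ℝ} (hpos : ∀ x, 0 < h x) : 0 ≤ lorentzV h :=
  inv_nonneg.2 (intervalIntegral.integral_nonneg zero_le_one fun x _ => (inv_pos.2 (hpos x)).le)

theorem IsSmoothPath.continuousOn_uncurry {γ : ℝ → Diff1} (hγ : IsSmoothPath γ) :
    ContinuousOn (fun p : ℝ × ℝ => γ p.1 p.2) (Icc (0 : ℝ) 1 ×ˢ univ) :=
  ContDiffOn.continuousOn hγ

theorem IsSmoothPath.continuousOn_apply {γ : ℝ → Diff1} (hγ : IsSmoothPath γ) (x : ℝ) :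
    ContinuousOn (fun t => γ t x) (Icc (0 : ℝ) 1) :=
  hγ.continuousOn_uncurry.comp (f := fun t : ℝ => (t, x)) (by fun_prop)
    fun _ ht => ⟨ht, mem_univ _⟩

theorem IsSmoothPath.continuous {γ : ℝ → Diff1} (hγ : IsSmoothPath γ) {t : ℝ}
    (ht : t ∈ Icc (0 : ℝ) 1) : Continuous (γ t) :=
  hγ.continuousOn_uncurry.comp_continuous (f := fun x : ℝ => (t, x)) (by fun_prop)
    fun _ => ⟨ht, mem_univ _⟩

theorem IsSmoothPath.hasDerivAt {γ : ℝ → Diff1} (hγ : IsSmoothPath γ) {t : ℝ}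
    (ht : t ∈ Ioo (0 : ℝ) 1) (x : ℝ) :
    HasDerivAt (fun τ => γ τ x) (hamiltonian γ t (γ t x)) t :=
  ((generates_iff hγ _).2 (fun _ _ _ => rfl) t (Ioo_subset_Icc_self ht) x).hasDerivAt
    (Icc_mem_nhds ht.1 ht.2)

theorem IsPositivePath.monotoneOn {γ : ℝ → Diff1} (hγ : IsPositivePath γ) (x : ℝ) :
    MonotoneOn (fun t => γ t x) (Icc (0 : ℝ) 1) := by
  refine monotoneOn_of_deriv_nonneg (convex_Icc _ _) (hγ.1.continuousOn_apply x) ?_ ?_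
  · intro t ht
    rw [interior_Icc] at ht
    exact (hγ.1.hasDerivAt ht x).differentiableAt.differentiableWithinAt
  · intro t ht
    rw [interior_Icc] at ht
    rw [(hγ.1.hasDerivAt ht x).deriv]
    exact (hγ.2 t (Ioo_subset_Icc_self ht) _).le

theorem lengthV_le_of_isTrigPoly {k : ℕ} (hk : 1 ≤ k) {φ : Diff1} {s : ℝ} (hs : 0 < s)
    (hs1 : s < 1) (hφ : ∀ x, φ x ≤ x + s / (4 * k)) {γ : ℝ → Diff1} (hγ : IsPositivePath γ)
    (h0 : γ 0 = refl) (h1 : γ 1 = φ) (hH : IsTrigPoly k (hamiltonian γ)) :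
    lengthV γ ≤ 1 / (1 - s) * ∫ x in (0 : ℝ)..1, (φ x - x) := by
  obtain ⟨a, b, ha, hb, hab⟩ := hH
  have hk0 : (0 : ℝ) < k := by positivity
  have hH' : ∀ t ∈ Icc (0 : ℝ) 1, hamiltonian γ t = trigPoly k (a · t) (b · t) :=
    fun t ht => funext fun x => hab t ht x
  set K : ℝ → ℝ → ℝ := fun t x => trigPoly k (a · t) (b · t) (γ t x) with hK
  have hKc : ContinuousOn (Function.uncurry K) (Icc (0 : ℝ) 1 ×ˢ univ) := by
    have hfst : MapsTo (Prod.fst : ℝ × ℝ → ℝ) (Icc (0 : ℝ) 1 ×ˢ univ) (Icc 0 1) :=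
      fun p hp => hp.1
    have hγc := hγ.1.continuousOn_uncurry
    simp only [hK, Function.uncurry_def, trigPoly]
    refine continuousOn_finsetSum _ fun j _ => ContinuousOn.add ?_ ?_
    · exact ((ha j).continuousOn.comp continuousOn_fst hfst).mul
        (Real.continuous_cos.comp_continuousOn (continuousOn_const.mul hγc))
    · exact ((hb j).continuousOn.comp continuousOn_fst hfst).mul
        (Real.continuous_sin.comp_continuousOn (continuousOn_const.mul hγc))
  have hKc' : ContinuousOn (Function.uncurry K) (Icc (0 : ℝ) 1 ×ˢ Icc (0 : ℝ) 1) :=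
    hKc.mono (prod_mono le_rfl (subset_univ _))
  have hpos : ∀ t ∈ Icc (0 : ℝ) 1, ∀ x, 0 < trigPoly k (a · t) (b · t) x := by
    intro t ht x
    rw [← hH' t ht]
    exact hγ.2 t ht x
  have hV : ∀ t ∈ Icc (0 : ℝ) 1,
      lorentzV (hamiltonian γ t) ≤ 1 / (1 - s) * ∫ x in (0 : ℝ)..1, K t x := by
    intro t ht
    -- Positivity makes t ↦ φᵗ(x) monotone, which traps φᵗ(x) between x and φ(x).
    have hint := integral_trigPoly_comp_ge hk (fun x => (hpos t ht x).le) (hγ.1.continuous ht)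
      (δ := s / (4 * k))
      (fun x => by
        have h := hγ.monotoneOn x ⟨le_rfl, zero_le_one⟩ ht ht.1
        have hx : γ 0 x = x := by rw [h0]; rfl
        dsimp only at h
        rwa [hx] at h)
      (fun x => by
        have h := hγ.monotoneOn x ht ⟨zero_le_one, le_rfl⟩ ht.2
        dsimp only at h
        rw [h1] at h
        exact h.trans (hφ x))
    have hle := lorentzV_le_integral (continuous_trigPoly k (a · t) (b · t)) (hpos t ht)
    have hnn := lorentzV_nonneg (hpos t ht)
    rw [hH' t ht, one_div, ← div_eq_inv_mul, le_div_iff₀ (by linarith)]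
    refine le_trans ?_ hint
    have hπ : 1 - s ≤ 1 - Real.pi * k * (s / (4 * k)) := by
      have : Real.pi * k * (s / (4 * k)) = Real.pi / 4 * s := by field_simp
      rw [this]
      nlinarith [Real.pi_le_four]
    calc lorentzV (trigPoly k (a · t) (b · t)) * (1 - s)
        ≤ (∫ x in (0 : ℝ)..1, trigPoly k (a · t) (b · t) x) * (1 - s) :=
          mul_le_mul_of_nonneg_right hle (by linarith)
      _ ≤ _ := by
          rw [mul_comm]
          exact mul_le_mul_of_nonneg_right hπ (hnn.trans hle)
  have hswap : ∫ t in (0 : ℝ)..1, ∫ x in (0 : ℝ)..1, K t x =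
      ∫ x in (0 : ℝ)..1, ∫ t in (0 : ℝ)..1, K t x := by
    refine intervalIntegral_intervalIntegral_swap ?_
    rw [uIoc_of_le zero_le_one]
    exact (hKc'.integrableOn_compact (isCompact_Icc.prod isCompact_Icc)).mono_set
      (prod_mono Ioc_subset_Icc_self Ioc_subset_Icc_self)
  have hFTC : ∀ x, ∫ t in (0 : ℝ)..1, K t x = φ x - x := by
    intro x
    rw [intervalIntegral.integral_eq_sub_of_hasDerivAt_of_le zero_le_one
      (hγ.1.continuousOn_apply x)]
    · rw [h0, h1]
      rfl
    · intro t ht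
      have := hγ.1.hasDerivAt ht x
      rwa [hH' t (Ioo_subset_Icc_self ht)] at this
    · refine ContinuousOn.intervalIntegrable ?_
      rw [uIcc_of_le zero_le_one]
      exact hKc.comp (f := fun t : ℝ => (t, x)) (by fun_prop) fun _ ht => ⟨ht, mem_univ _⟩
  have hKint : IntervalIntegrable (fun t => ∫ x in (0 : ℝ)..1, K t x) volume 0 1 := by
    rw [intervalIntegrable_iff_integrableOn_Ioc_of_le zero_le_one]
    simp_rw [intervalIntegral.integral_of_le zero_le_one]
    have : IntegrableOn (Function.uncurry K) (Ioc (0 : ℝ) 1 ×ˢ Ioc (0 : ℝ) 1) :=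
      (hKc'.integrableOn_compact (isCompact_Icc.prod isCompact_Icc)).mono_set
        (prod_mono Ioc_subset_Icc_self Ioc_subset_Icc_self)
    rw [IntegrableOn, Measure.volume_eq_prod, ← Measure.prod_restrict] at this
    exact this.integral_prod_left
  calc lengthV γ ≤ ∫ t in (0 : ℝ)..1, 1 / (1 - s) * ∫ x in (0 : ℝ)..1, K t x := by
        rw [lengthV, intervalIntegral.integral_of_le zero_le_one,
          intervalIntegral.integral_of_le zero_le_one]
        -- Only the larger integrand must be integrable, so regularity of V(H(t, ·)) in t is not
        -- needed.
        refine integral_mono_of_nonneg ?_ (hKint.const_mul _).1 ?_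
        · filter_upwards [ae_restrict_mem measurableSet_Ioc] with t ht
          exact lorentzV_nonneg (hγ.2 t (Ioc_subset_Icc_self ht))
        · filter_upwards [ae_restrict_mem measurableSet_Ioc] with t ht
          exact hV t (Ioc_subset_Icc_self ht)
    _ = _ := by
        rw [intervalIntegral.integral_const_mul, hswap]
        simp_rw [hFTC]

end Diff1

/-! ### Lifted Möbius transformations and their k-fold covers -/

/-- The lift to the real line of the action on the circle of the Blaschke factor
`z ↦ (z - a) / (1 - a z)`. -/
noncomputable def mobius (a θ : ℝ) : ℝ :=
  θ + 2 * Real.arctan (a * Real.sin θ / (1 - a * Real.cos θ))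

/-- The squared modulus of `1 - a exp (i θ)`. -/
noncomputable def mobiusDen (a θ : ℝ) : ℝ := 1 + a ^ 2 - 2 * a * Real.cos θ

theorem one_sub_mul_cos_pos {a : ℝ} (ha : |a| < 1) (θ : ℝ) : 0 < 1 - a * Real.cos θ := by
  have h1 : |a * Real.cos θ| ≤ |a| * 1 := by
    rw [abs_mul]
    exact mul_le_mul_of_nonneg_left (Real.abs_cos_le_one θ) (abs_nonneg a)
  linarith [le_abs_self (a * Real.cos θ)]

theorem mobiusDen_eq (a θ : ℝ) :
    mobiusDen a θ = (1 - a * Real.cos θ) ^ 2 + (a * Real.sin θ) ^ 2 := by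
  unfold mobiusDen
  linear_combination (-a ^ 2) * Real.sin_sq_add_cos_sq θ

theorem mobiusDen_pos {a : ℝ} (ha : |a| < 1) (θ : ℝ) : 0 < mobiusDen a θ := by
  rw [mobiusDen_eq]
  have := one_sub_mul_cos_pos ha θ
  positivity

theorem one_sub_sq_pos_of_abs_lt_one {a : ℝ} (ha : |a| < 1) : 0 < 1 - a ^ 2 := by
  have := (sq_lt_one_iff_abs_lt_one a).2 ha
  linarith

theorem cos_two_mul_arctan_div {p : ℝ} (hp : p ≠ 0) (q : ℝ) :
    Real.cos (2 * Real.arctan (q / p)) = (p ^ 2 - q ^ 2) / (p ^ 2 + q ^ 2) := by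
  have h : 1 + (q / p) ^ 2 = (p ^ 2 + q ^ 2) / p ^ 2 := by field_simp
  have h2 : p ^ 2 + q ^ 2 ≠ 0 := by positivity
  rw [Real.cos_two_mul, Real.cos_sq_arctan, h]
  field_simp
  ring

theorem sin_two_mul_arctan_div {p : ℝ} (hp : p ≠ 0) (q : ℝ) :
    Real.sin (2 * Real.arctan (q / p)) = 2 * p * q / (p ^ 2 + q ^ 2) := by
  have h : 1 + (q / p) ^ 2 = (p ^ 2 + q ^ 2) / p ^ 2 := by field_simp
  have h2 : p ^ 2 + q ^ 2 ≠ 0 := by positivity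
  rw [Real.sin_two_mul, ← Real.tan_mul_cos (Real.cos_arctan_pos (q / p)).ne', Real.tan_arctan,
    mul_assoc, mul_assoc, ← pow_two, Real.cos_sq_arctan, h]
  field_simp

theorem cos_mobius {a : ℝ} (ha : |a| < 1) (θ : ℝ) :
    Real.cos (mobius a θ) = ((1 + a ^ 2) * Real.cos θ - 2 * a) / mobiusDen a θ := by
  have h1 := (one_sub_mul_cos_pos ha θ).ne'
  rw [mobius, Real.cos_add, cos_two_mul_arctan_div h1, sin_two_mul_arctan_div h1, ← mobiusDen_eq,
    mul_div_assoc', mul_div_assoc', ← sub_div]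
  congr 1
  linear_combination (a ^ 2 * Real.cos θ - 2 * a) * Real.sin_sq_add_cos_sq θ

theorem sin_mobius {a : ℝ} (ha : |a| < 1) (θ : ℝ) :
    Real.sin (mobius a θ) = (1 - a ^ 2) * Real.sin θ / mobiusDen a θ := by
  have h1 := (one_sub_mul_cos_pos ha θ).ne'
  rw [mobius, Real.sin_add, cos_two_mul_arctan_div h1, sin_two_mul_arctan_div h1, ← mobiusDen_eq,
    mul_div_assoc', mul_div_assoc', ← add_div]
  congr 1
  linear_combination (-a ^ 2 * Real.sin θ) * Real.sin_sq_add_cos_sq θ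

/-- Equivalently, the derivatives of `mobius a` and of its inverse `mobius (-a)` at corresponding
points are reciprocal. -/
theorem mobiusDen_neg_mobius {a : ℝ} (ha : |a| < 1) (θ : ℝ) :
    mobiusDen (-a) (mobius a θ) = (1 - a ^ 2) ^ 2 / mobiusDen a θ := by
  have h2 := (mobiusDen_pos ha θ).ne'
  rw [mobiusDen, cos_mobius ha]
  field_simp
  rw [mobiusDen]
  ring

/-- The two arctangents have opposite arguments, so they cancel exactly, with no ambiguity modulo
2π. -/
theorem mobius_neg_mobius {a : ℝ} (ha : |a| < 1) (θ : ℝ) : mobius (-a) (mobius a θ) = θ := by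
  have h1 := (one_sub_mul_cos_pos ha θ).ne'
  have h2 := (mobiusDen_pos ha θ).ne'
  have h3 := (one_sub_sq_pos_of_abs_lt_one ha).ne'
  have h4 : 1 - -a * Real.cos (mobius a θ) =
      (1 - a ^ 2) * (1 - a * Real.cos θ) / mobiusDen a θ := by
    rw [cos_mobius ha]
    field_simp
    rw [mobiusDen]
    ring
  have h5 : -a * Real.sin (mobius a θ) / (1 - -a * Real.cos (mobius a θ)) =
      -(a * Real.sin θ / (1 - a * Real.cos θ)) := by
    rw [h4, sin_mobius ha]
    field_simp
  rw [mobius, h5, Real.arctan_neg, mobius]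
  ring

theorem contDiff_mobius {a : ℝ} (ha : |a| < 1) : ContDiff ℝ ∞ (mobius a) := by
  unfold mobius
  refine contDiff_id.add (contDiff_const.mul (Real.contDiff_arctan.comp ?_))
  exact (contDiff_const.mul Real.contDiff_sin).div
    (contDiff_const.sub (contDiff_const.mul Real.contDiff_cos))
    fun θ => (one_sub_mul_cos_pos ha θ).ne'

theorem hasDerivAt_mobius {a : ℝ} (ha : |a| < 1) (θ : ℝ) :
    HasDerivAt (mobius a) ((1 - a ^ 2) / mobiusDen a θ) θ := by
  have h1 := (one_sub_mul_cos_pos ha θ).ne'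
  have h2 := (mobiusDen_pos ha θ).ne'
  rw [mobiusDen_eq] at h2
  have hd := ((Real.hasDerivAt_sin θ).const_mul a).fun_div
    (((Real.hasDerivAt_cos θ).const_mul a).const_sub 1) h1
  refine ((hasDerivAt_id θ).fun_add (hd.arctan.const_mul 2)).congr_deriv ?_
  have h3 : 1 + (a * Real.sin θ / (1 - a * Real.cos θ)) ^ 2 =
      ((1 - a * Real.cos θ) ^ 2 + (a * Real.sin θ) ^ 2) / (1 - a * Real.cos θ) ^ 2 := by
    field_simp
  rw [h3, mobiusDen_eq]
  field_simp
  linear_combination (-a ^ 2) * Real.sin_sq_add_cos_sq θ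

theorem mobius_add_nat_mul_two_pi (a θ : ℝ) (n : ℕ) :
    mobius a (θ + n * (2 * Real.pi)) = mobius a θ + n * (2 * Real.pi) := by
  rw [mobius, Real.sin_add_nat_mul_two_pi, Real.cos_add_nat_mul_two_pi, mobius]
  ring

theorem mobius_add_two_pi (a θ : ℝ) :
    mobius a (θ + 2 * Real.pi) = mobius a θ + 2 * Real.pi := by
  simpa using mobius_add_nat_mul_two_pi a θ 1

/-- The conjugate of `mobius a` by the homothety `x ↦ 2 π k x`. -/
noncomputable def circleMobius (k : ℕ) (a x : ℝ) : ℝ :=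
  mobius a (2 * Real.pi * k * x) / (2 * Real.pi * k)

section circleMobius

variable {k : ℕ} {a : ℝ}

theorem two_pi_mul_circleMobius (hk : 1 ≤ k) (x : ℝ) :
    2 * Real.pi * k * circleMobius k a x = mobius a (2 * Real.pi * k * x) := by
  have : (0 : ℝ) < k := by positivity
  rw [circleMobius, mul_div_cancel₀ _ (by positivity)]

theorem circleMobius_neg_circleMobius (hk : 1 ≤ k) (ha : |a| < 1) (x : ℝ) :
    circleMobius k (-a) (circleMobius k a x) = x := by
  have : (0 : ℝ) < k := by positivity
  rw [circleMobius, two_pi_mul_circleMobius hk, mobius_neg_mobius ha,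
    mul_div_cancel_left₀ _ (by positivity)]

theorem circleMobius_circleMobius_neg (hk : 1 ≤ k) (ha : |a| < 1) (x : ℝ) :
    circleMobius k a (circleMobius k (-a) x) = x := by
  simpa using circleMobius_neg_circleMobius (a := -a) hk (by simpa using ha) x

/-- This centrality of translation by 1/k makes the endpoint of `mobiusPath` independent of a. -/
theorem circleMobius_add_inv (hk : 1 ≤ k) (x : ℝ) :
    circleMobius k a (x + 1 / k) = circleMobius k a x + 1 / k := by
  have : (0 : ℝ) < k := by positivity
  have h : 2 * Real.pi * k * (x + 1 / k) = 2 * Real.pi * k * x + 2 * Real.pi := by field_simp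
  rw [circleMobius, h, mobius_add_two_pi, circleMobius]
  field_simp

theorem circleMobius_add_one (hk : 1 ≤ k) (x : ℝ) :
    circleMobius k a (x + 1) = circleMobius k a x + 1 := by
  have : (0 : ℝ) < k := by positivity
  have h : 2 * Real.pi * k * (x + 1) = 2 * Real.pi * k * x + k * (2 * Real.pi) := by ring
  rw [circleMobius, h, mobius_add_nat_mul_two_pi, circleMobius]
  field_simp

theorem contDiff_circleMobius (ha : |a| < 1) : ContDiff ℝ ∞ (circleMobius k a) :=
  ((contDiff_mobius ha).comp (contDiff_const.mul contDiff_id)).div_const _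

theorem hasDerivAt_circleMobius (hk : 1 ≤ k) (ha : |a| < 1) (x : ℝ) :
    HasDerivAt (circleMobius k a) ((1 - a ^ 2) / mobiusDen a (2 * Real.pi * k * x)) x := by
  have : (0 : ℝ) < k := by positivity
  have h0 : HasDerivAt (fun x : ℝ => 2 * Real.pi * k * x) (2 * Real.pi * k) x := by
    simpa using (hasDerivAt_id x).const_mul (2 * Real.pi * k)
  refine (((hasDerivAt_mobius ha _).comp x h0).div_const (2 * Real.pi * k)).congr_deriv ?_
  field_simp

end circleMobius

/-! ### Long positive paths to a translation -/

namespace Diff1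

/-- The element of `Diff₁(ℝ)` given by a smooth function and a smooth inverse. -/
def ofInverse (f g : ℝ → ℝ) (hgf : Function.LeftInverse g f) (hfg : Function.RightInverse g f)
    (hf : ContDiff ℝ ∞ f) (hg : ContDiff ℝ ∞ g) (h1 : ∀ x, f (x + 1) = 1 + f x) : Diff1 :=
  ⟨⟨⟨f, g, hgf, hfg⟩, hf.contMDiff, hg.contMDiff⟩, h1⟩

theorem ext_apply {φ ψ : Diff1} (h : ∀ x, φ x = ψ x) : φ = ψ :=
  Subtype.ext (Diffeomorph.ext h)

/-- Translations. -/
def translation (c : ℝ) : Diff1 :=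
  ofInverse (fun x => x + c) (fun x => x - c) (fun x => add_sub_cancel_right x c)
    (fun x => sub_add_cancel x c) (contDiff_id.add contDiff_const)
    (contDiff_id.sub contDiff_const) (fun x => by ring)

/-- The product of a conjugate of a rotation by an element of a `k`-fold cover of `PSL(2, ℝ)` with
another rotation. -/
noncomputable def mobiusPath {k : ℕ} (hk : 1 ≤ k) {a : ℝ} (ha : |a| < 1) (ε t : ℝ) : Diff1 :=
  ofInverse (fun x => circleMobius k a (circleMobius k (-a) (x + ε * t) + t / k))
    (fun y => circleMobius k a (circleMobius k (-a) y - t / k) - ε * t)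
    (fun x => by
      simp only [circleMobius_neg_circleMobius hk ha, add_sub_cancel_right,
        circleMobius_circleMobius_neg hk ha])
    (fun y => by
      simp only [circleMobius_neg_circleMobius hk ha, sub_add_cancel,
        circleMobius_circleMobius_neg hk ha])
    ((contDiff_circleMobius ha).comp
      (((contDiff_circleMobius (by simpa using ha)).comp (contDiff_id.add contDiff_const)).add
        contDiff_const))
    (((contDiff_circleMobius ha).comp
      ((contDiff_circleMobius (by simpa using ha)).sub contDiff_const)).sub contDiff_const)
    (fun x => by
      rw [add_right_comm x 1, circleMobius_add_one hk, add_right_comm _ (1 : ℝ),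
        circleMobius_add_one hk, add_comm])

/-- The Hamiltonian of `mobiusPath`. -/
noncomputable def mobiusHam (k : ℕ) (a ε t y : ℝ) : ℝ :=
  (1 / k + ε * mobiusDen a (mobius (-a) (2 * Real.pi * k * y) - 2 * Real.pi * t) / (1 - a ^ 2)) *
    (mobiusDen (-a) (2 * Real.pi * k * y) / (1 - a ^ 2))

section mobiusPath

variable {k : ℕ} (hk : 1 ≤ k) {a : ℝ} (ha : |a| < 1) {ε : ℝ}

theorem mobiusPath_apply (t x : ℝ) : mobiusPath hk ha ε t x =
    circleMobius k a (circleMobius k (-a) (x + ε * t) + t / k) := rfl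

theorem isSmoothPath_mobiusPath : IsSmoothPath (mobiusPath hk ha ε) := by
  have ha' : |-a| < 1 := by simpa using ha
  refine ContDiff.contDiffOn ?_
  simp only [mobiusPath_apply]
  exact (contDiff_circleMobius ha).comp (((contDiff_circleMobius ha').comp
    (contDiff_snd.add (contDiff_const.mul contDiff_fst))).add (contDiff_fst.div_const _))

theorem mobiusPath_zero : mobiusPath hk ha ε 0 = refl := by
  refine ext_apply fun x => ?_
  rw [mobiusPath_apply]
  simp only [mul_zero, add_zero, zero_div, circleMobius_circleMobius_neg hk ha]
  rfl

theorem mobiusPath_one : mobiusPath hk ha ε 1 = translation (1 / k + ε) := by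
  refine ext_apply fun x => ?_
  rw [mobiusPath_apply, circleMobius_add_inv hk, circleMobius_circleMobius_neg hk ha, mul_one,
    add_assoc, add_comm ε]
  rfl

theorem mobiusHam_pos (hk : 1 ≤ k) (ha : |a| < 1) (hε : 0 < ε) (t y : ℝ) : 0 < mobiusHam k a ε t y := by
  have hk0 : (0 : ℝ) < k := by positivity
  have h1 := one_sub_sq_pos_of_abs_lt_one ha
  have h2 := mobiusDen_pos ha (mobius (-a) (2 * Real.pi * k * y) - 2 * Real.pi * t)
  have h3 := mobiusDen_pos (a := -a) (by simpa using ha) (2 * Real.pi * k * y)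
  unfold mobiusHam
  positivity

theorem hamiltonian_mobiusPath {t : ℝ} (ht : t ∈ Icc (0 : ℝ) 1) :
    hamiltonian (mobiusPath hk ha ε) t = mobiusHam k a ε t := by
  have hk0 : (0 : ℝ) < k := by positivity
  have ha' : |-a| < 1 := by simpa using ha
  have h1 := (one_sub_sq_pos_of_abs_lt_one ha).ne'
  funext y
  refine ((generates_iff (isSmoothPath_mobiusPath hk ha) (mobiusHam k a ε)).1 ?_ t ht y).symm
  intro t _ x
  refine HasDerivAt.hasDerivWithinAt ?_
  have hx : HasDerivAt (fun τ : ℝ => x + ε * τ) ε t := by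
    simpa using ((hasDerivAt_id t).const_mul ε).const_add x
  have hd := (hasDerivAt_circleMobius hk ha _).comp t
    (((hasDerivAt_circleMobius hk ha' _).comp t hx).add ((hasDerivAt_id t).div_const (k : ℝ)))
  refine hd.congr_deriv ?_
  have h2 : 2 * Real.pi * k * (circleMobius k (-a) (x + ε * t) + t / k) =
      mobius (-a) (2 * Real.pi * k * (x + ε * t)) + 2 * Real.pi * t := by
    rw [mul_add, two_pi_mul_circleMobius hk]
    field_simp
  have h3 := mobiusDen_neg_mobius ha' (2 * Real.pi * k * (x + ε * t))
  have h4 := (mobiusDen_pos ha' (2 * Real.pi * k * (x + ε * t))).ne'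
  have h5 := (mobiusDen_pos ha
    (mobius (-a) (2 * Real.pi * k * (x + ε * t)) + 2 * Real.pi * t)).ne'
  rw [neg_neg, neg_sq] at h3
  simp only [mobiusHam, mobiusPath_apply, two_pi_mul_circleMobius hk, Function.comp_apply,
    Pi.add_apply, id, h2, mobius_neg_mobius ha, mobiusDen_neg_mobius ha, add_sub_cancel_right, h3]
  field_simp
  ring

/-- With C = cosh and S = sinh of the boost parameter, the factors are A - εS cos ξ and C + S
cos(2πkx), where ξ is the shifted Möbius angle. The second factor clears the denominator of cos ξ,
leaving only frequencies 0 and k. -/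
theorem isTrigPoly_mobiusHam (hk : 1 ≤ k) (ha : |a| < 1) : IsTrigPoly k (mobiusHam k a ε) := by
  have h1 := (one_sub_sq_pos_of_abs_lt_one ha).ne'
  have ha' : |-a| < 1 := by simpa using ha
  set C := (1 + a ^ 2) / (1 - a ^ 2) with hC
  set S := 2 * a / (1 - a ^ 2) with hS
  set A := 1 / k + ε * C with hA
  refine ⟨fun j t => if j = 0 then A * C - ε * S ^ 2 * Real.cos (2 * Real.pi * t) else
      if j = k then A * S - ε * S * C * Real.cos (2 * Real.pi * t) else 0,
    fun j t => if j = k then -ε * S * Real.sin (2 * Real.pi * t) else 0, ?_, ?_, ?_⟩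
  · intro j
    dsimp only
    split_ifs <;> fun_prop
  · intro j
    dsimp only
    split_ifs <;> fun_prop
  · intro t _ x
    rw [Finset.sum_eq_add_of_mem 0 k (by simp) (by simp) (by omega)]
    · have h2 := (mobiusDen_pos ha' (2 * Real.pi * k * x)).ne'
      have hk1 : k ≠ 0 := by omega
      simp only [if_true, hk1, hk1.symm, if_false, Nat.cast_zero, mul_zero, zero_mul,
        Real.cos_zero, Real.sin_zero, add_zero, mul_one]
      rw [mobiusHam, mobiusDen, Real.cos_sub, cos_mobius ha', sin_mobius ha']
      have h4 : mobiusDen (-a) (2 * Real.pi * k * x) =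
          1 + a ^ 2 + 2 * a * Real.cos (2 * Real.pi * k * x) := by
        rw [mobiusDen]
        ring
      have hk0 : (k : ℝ) ≠ 0 := by positivity
      rw [hA, hC, hS]
      generalize mobiusDen (-a) (2 * Real.pi * k * x) = D at h2 h4 ⊢
      field_simp
      rw [h4]
      ring_nf
    · intro j _ hj
      simp [hj.1, hj.2]

/-- A further Möbius change of coordinate, with parameter b, turns the field into the constant field
N. That coordinate divided by N is thus a primitive of 1/H, growing by 1/N over a period. -/
theorem lorentzV_mobiusHam (hk : 1 ≤ k) (ha : |a| < 1) (hε : 0 < ε) (t : ℝ) :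
    lorentzV (mobiusHam k a ε t) =
      √((1 / k + ε * ((1 + a ^ 2) / (1 - a ^ 2))) ^ 2 - (ε * (2 * a / (1 - a ^ 2))) ^ 2) := by
  have hk0 : (0 : ℝ) < k := by positivity
  have ha' : |-a| < 1 := by simpa using ha
  have h1 := one_sub_sq_pos_of_abs_lt_one ha
  set C := (1 + a ^ 2) / (1 - a ^ 2) with hC
  set S := 2 * a / (1 - a ^ 2) with hS
  have hCS : C ^ 2 - S ^ 2 = 1 := by
    rw [hC, hS]
    field_simp
    ring
  have hC0 : 0 < C := by positivity
  set A := 1 / k + ε * C with hA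
  have hA0 : 0 < A := by positivity
  have hN2 : 0 < A ^ 2 - (ε * S) ^ 2 := by
    have : A ^ 2 - (ε * S) ^ 2 = (1 / k) ^ 2 + 2 * (1 / k) * ε * C + ε ^ 2 := by
      rw [hA]
      linear_combination ε ^ 2 * hCS
    rw [this]
    positivity
  set N := √(A ^ 2 - (ε * S) ^ 2) with hN
  have hN0 : 0 < N := Real.sqrt_pos.2 hN2
  have hNN : N ^ 2 = A ^ 2 - (ε * S) ^ 2 := Real.sq_sqrt hN2.le
  set b := ε * S / (A + N) with hb
  have hAN : A + N ≠ 0 := by positivity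
  have hb1 : 1 - b ^ 2 = 2 * N / (A + N) := by
    rw [hb]
    field_simp
    linear_combination (-1) * hNN
  have hb2 : 1 + b ^ 2 = 2 * A / (A + N) := by
    rw [hb]
    field_simp
    linear_combination hNN
  have hb3 : |b| < 1 := by
    rw [← sq_lt_one_iff_abs_lt_one]
    have : 0 < 1 - b ^ 2 := by
      rw [hb1]
      positivity
    linarith
  have hd : ∀ y, HasDerivAt
      (fun y => circleMobius k b (circleMobius k (-a) y - t / k) / N) (mobiusHam k a ε t y)⁻¹ y := by
    intro y
    refine (((hasDerivAt_circleMobius hk hb3 _).comp y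
      ((hasDerivAt_circleMobius hk ha' y).sub_const (t / k))).div_const N).congr_deriv ?_
    have h2 : 2 * Real.pi * k * (circleMobius k (-a) y - t / k) =
        mobius (-a) (2 * Real.pi * k * y) - 2 * Real.pi * t := by
      rw [mul_sub, two_pi_mul_circleMobius hk]
      field_simp
    rw [h2, mobiusHam, hb1]
    set ξ := mobius (-a) (2 * Real.pi * k * y) - 2 * Real.pi * t
    have h3 := (mobiusDen_pos ha' (2 * Real.pi * k * y)).ne'
    have h4 := (mobiusDen_pos hb3 ξ).ne'
    have h5 : mobiusDen b ξ = 2 * (1 / k + ε * mobiusDen a ξ / (1 - a ^ 2)) / (A + N) := by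
      rw [mobiusDen, hb2, hb, hA, hC, hS, mobiusDen]
      field_simp
      ring
    have h6 : (1 / k + ε * mobiusDen a ξ / (1 - a ^ 2)) ≠ 0 := by
      have := mobiusDen_pos ha ξ
      positivity
    rw [h5, neg_sq]
    set B := 1 / k + ε * mobiusDen a ξ / (1 - a ^ 2)
    field_simp
  have hc : Continuous fun y => (mobiusHam k a ε t y)⁻¹ := by
    refine Continuous.inv₀ ?_ fun y => (mobiusHam_pos hk ha hε t y).ne'
    have := (contDiff_mobius ha').continuous
    unfold mobiusHam mobiusDen
    fun_prop
  rw [lorentzV, intervalIntegral.integral_eq_sub_of_hasDerivAt (fun y _ => hd y)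
    (hc.intervalIntegrable _ _), inv_eq_iff_eq_inv]
  have h7 : circleMobius k (-a) 1 = circleMobius k (-a) 0 + 1 := by
    simpa using circleMobius_add_one hk 0
  rw [h7, add_sub_right_comm, circleMobius_add_one hk]
  field_simp
  ring

theorem lengthV_mobiusPath (hε : 0 < ε) :
    lengthV (mobiusPath hk ha ε) =
      √((1 / k + ε * ((1 + a ^ 2) / (1 - a ^ 2))) ^ 2 - (ε * (2 * a / (1 - a ^ 2))) ^ 2) := by
  rw [lengthV, intervalIntegral.integral_congr (g := fun _ =>
    √((1 / k + ε * ((1 + a ^ 2) / (1 - a ^ 2))) ^ 2 - (ε * (2 * a / (1 - a ^ 2))) ^ 2))]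
  · simp
  · intro t ht
    rw [uIcc_of_le zero_le_one] at ht
    dsimp only
    rw [hamiltonian_mobiusPath hk ha ht, lorentzV_mobiusHam hk ha hε]

end mobiusPath

/-- Arbitrarily long positive paths from the identity to a translation by more than `1 / k`. -/
theorem exists_long_path_to_translation {k : ℕ} (hk : 1 ≤ k) {ε : ℝ} (hε : 0 < ε) (L : ℝ) :
    ∃ γ : ℝ → Diff1, IsPositivePath γ ∧ γ 0 = refl ∧ γ 1 = translation (1 / k + ε) ∧
      IsTrigPoly k (hamiltonian γ) ∧ L < lengthV γ := by
  have hk0 : (0 : ℝ) < k := by positivity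
  -- Taking 1 - a² = 1/(1 + M) forces cosh ≥ 1 + M, and the cross term then exceeds 2(ε/k)M = 2L².
  set M := k * L ^ 2 / ε with hM
  have hM0 : 0 ≤ M := by positivity
  set q := 1 / (1 + M) with hq
  have hq0 : 0 < q := by positivity
  have hq1 : q ≤ 1 := by
    rw [hq, div_le_one (by positivity)]
    linarith
  set a := √(1 - q) with ha_def
  have haq : a ^ 2 = 1 - q := Real.sq_sqrt (by linarith)
  have ha : |a| < 1 := by
    rw [← sq_lt_one_iff_abs_lt_one, haq]
    linarith
  refine ⟨mobiusPath hk ha ε, ⟨isSmoothPath_mobiusPath hk ha, fun t ht y => ?_⟩,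
    mobiusPath_zero hk ha, mobiusPath_one hk ha, ?_, ?_⟩
  · rw [hamiltonian_mobiusPath hk ha ht]
    exact mobiusHam_pos hk ha hε t y
  · obtain ⟨c, d, hc, hd, h⟩ := isTrigPoly_mobiusHam (ε := ε) hk ha
    refine ⟨c, d, hc, hd, fun t ht x => ?_⟩
    rw [hamiltonian_mobiusPath hk ha ht]
    exact h t ht x
  · rw [lengthV_mobiusPath hk ha hε]
    refine Real.lt_sqrt_of_sq_lt ?_
    have h1 : 1 - a ^ 2 ≠ 0 := (one_sub_sq_pos_of_abs_lt_one ha).ne'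
    have h2 : (1 / k + ε * ((1 + a ^ 2) / (1 - a ^ 2))) ^ 2 - (ε * (2 * a / (1 - a ^ 2))) ^ 2 =
        (1 / k) ^ 2 + 2 * ε / k * ((1 + a ^ 2) / (1 - a ^ 2)) + ε ^ 2 := by
      field_simp
      ring
    have h3 : 1 + M ≤ (1 + a ^ 2) / (1 - a ^ 2) := by
      rw [haq, sub_sub_cancel, le_div_iff₀ hq0, hq, mul_one_div_cancel (by positivity)]
      linarith
    have h4 : 2 * ε / k * (1 + M) = 2 * ε / k + 2 * L ^ 2 := by
      rw [hM]
      field_simp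
    have h5 : 2 * ε / k * (1 + M) ≤ 2 * ε / k * ((1 + a ^ 2) / (1 - a ^ 2)) :=
      mul_le_mul_of_nonneg_left h3 (by positivity)
    have h6 : 0 < 2 * ε / k := by positivity
    rw [h2]
    nlinarith [sq_nonneg L, sq_nonneg (1 / (k : ℝ)), sq_nonneg ε]

/-- A diffeomorphism that moves every point by more than `c` does so uniformly. -/
theorem exists_pos_add_lt {φ : Diff1} {c : ℝ} (h : ∀ x, x + c < φ x) :
    ∃ ε > 0, ∀ x, x + (c + ε) < φ x := by
  have hc : Continuous fun x => φ x - x := φ.1.continuous.sub continuous_id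
  obtain ⟨x₀, _, hx₀⟩ := isCompact_Icc.exists_isMinOn (nonempty_Icc.2 (zero_le_one' ℝ))
    hc.continuousOn
  have hp : Function.Periodic (fun x => φ x - x) 1 := by
    intro x
    have h1 : φ (x + 1) = 1 + φ x := φ.2 x
    change φ (x + 1) - (x + 1) = φ x - x
    linarith
  -- Half of the minimal excess keeps the inequality strict at the minimum.
  refine ⟨(φ x₀ - x₀ - c) / 2, by linarith [h x₀], fun x => ?_⟩
  obtain ⟨y, hy, hxy⟩ := hp.exists_mem_Ico₀ zero_lt_one x
  have h1 : φ x₀ - x₀ ≤ φ y - y := hx₀ (Ico_subset_Icc_self hy)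
  have h2 : φ x - x = φ y - y := hxy
  linarith [h x₀]

end Diff1

theorem mainTheorem4 (k : ℕ) (hk : 1 ≤ k) (φ : Diff1) :
    (∀ s : ℝ, 0 < s → s < 1 → (∀ x : ℝ, φ x ≤ x + s / (4 * k)) →
      ∀ γ : ℝ → Diff1, Diff1.IsPositivePath γ → γ 0 = Diff1.refl → γ 1 = φ →
        IsTrigPoly k (Diff1.hamiltonian γ) →
        Diff1.lengthV γ ≤ 1 / (1 - s) * ∫ x in (0 : ℝ)..1, (φ x - x)) ∧
    ((∀ x : ℝ, x + 1 / (k : ℝ) < φ x) →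
      ∃ ψ : Diff1, (∀ x : ℝ, x < ψ x ∧ ψ x < φ x) ∧
        ∀ L : ℝ, ∃ γ : ℝ → Diff1, Diff1.IsPositivePath γ ∧ γ 0 = Diff1.refl ∧ γ 1 = ψ ∧
          IsTrigPoly k (Diff1.hamiltonian γ) ∧ L < Diff1.lengthV γ) := by
  refine ⟨fun s hs hs1 hφ γ hγ h0 h1 hH =>
    Diff1.lengthV_le_of_isTrigPoly hk hs hs1 hφ hγ h0 h1 hH, fun h => ?_⟩
  obtain ⟨ε, hε, hlt⟩ := Diff1.exists_pos_add_lt h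
  have hk0 : (0 : ℝ) < k := by positivity
  refine ⟨Diff1.translation (1 / k + ε), fun x => ⟨?_, hlt x⟩,
    Diff1.exists_long_path_to_translation hk hε⟩
  have : 0 < 1 / (k : ℝ) + ε := by positivity
  exact lt_add_of_pos_right x this
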